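/- Let $G$ be a finite simple graph. A cyclic interval $t$-coloring of $G$ is a proper edge coloring $\alpha : E(G)\to\{1,\dots,t\}$ in which every one of the $t$ colors is used and such that, for every vertex $v$, either the set $S(v)$ of colors on the edges incident to $v$ is an interval of integers or $\{1,\dots,t\}\setminus S(v)$ is an interval of integers (the empty set counting as an interval). If $G$ has a cyclic interval $t$-coloring for some $t$, let $W_c(G)$ denote the largest such $t$. **Theorem.** Every triangle-free graph $G$ that has a cyclic interval coloring and has maximum degree $\Delta(G)\le 4$ satisfies $W_c(G)\le |V(G)|$. -/

import Mathlib

namespace CyclicInterval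

/-- The set `S(v, α)` of colors that appear on the edges of `G` incident to `v`. -/
def incidentColors {V : Type*} (G : SimpleGraph V) (α : Sym2 V → ℕ) (v : V) : Set ℕ :=
  {c | ∃ w, G.Adj v w ∧ α s(v, w) = c}

/-- An interval of integers (here colors are natural numbers). -/
def IsInterval (S : Set ℕ) : Prop :=
  ∃ a b : ℕ, S = Set.Icc a b

/-- `α` is a cyclic interval `t`-coloring of `G`. Only the values of `α` at edges of `G` matter. -/
structure IsCyclicIntervalColoring {V : Type*} (G : SimpleGraph V) (t : ℕ)
    (α : Sym2 V → ℕ) : Prop where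
  /-- the colors are `1, …, t` -/
  mem_Icc : ∀ e ∈ G.edgeSet, α e ∈ Set.Icc 1 t
  /-- two different edges with a common end have different colors -/
  proper : ∀ v w w' : V, G.Adj v w → G.Adj v w' → w ≠ w' → α s(v, w) ≠ α s(v, w')
  /-- the colors at every vertex, or the remaining colors, form an interval of integers -/
  interval : ∀ v : V, IsInterval (incidentColors G α v) ∨
    IsInterval (Set.Icc 1 t \ incidentColors G α v)
  /-- no color class is empty -/
  nonempty : ∀ c ∈ Set.Icc 1 t, ∃ e ∈ G.edgeSet, α e = c

/-- The set of all `t` for which `G` has a cyclic interval `t`-coloring. -/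
def colorNumbers {V : Type*} (G : SimpleGraph V) : Set ℕ :=
  {t | ∃ α : Sym2 V → ℕ, IsCyclicIntervalColoring G t α}

/-- `G` belongs to the class of cyclically interval colorable graphs. -/
def CyclicallyIntervalColorable {V : Type*} (G : SimpleGraph V) : Prop :=
  (colorNumbers G).Nonempty

/-- `W_c(G)`: the maximum number of colors in a cyclic interval coloring of `G`. For a finite
cyclically interval colorable graph this is a true maximum, see `isGreatest_Wc`. -/
noncomputable def Wc {V : Type*} (G : SimpleGraph V) : ℕ :=
  sSup (colorNumbers G)

theorem bddAbove_colorNumbers {V : Type*} [Finite V] (G : SimpleGraph V) :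
    BddAbove (colorNumbers G) := by
  refine ⟨G.edgeSet.ncard, ?_⟩
  rintro t ⟨α, hα⟩
  have h : Set.Icc 1 t ⊆ α '' G.edgeSet := fun c hc => hα.nonempty c hc
  have h1 := Set.ncard_le_ncard h (Set.toFinite _)
  have h2 := Set.ncard_image_le (f := α) (Set.toFinite G.edgeSet)
  have h3 : (Set.Icc 1 t).ncard = t := by
    rw [← Finset.coe_Icc, Set.ncard_coe_finset, Nat.card_Icc, Nat.add_sub_cancel]
  omega

theorem isGreatest_Wc {V : Type*} [Finite V] (G : SimpleGraph V)
    (hG : CyclicallyIntervalColorable G) : IsGreatest (colorNumbers G) (Wc G) :=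
  ⟨Nat.sSup_mem hG (bddAbove_colorNumbers G),
    fun _ ht => le_csSup (bddAbove_colorNumbers G) ht⟩

end CyclicInterval

/-!
A cyclic interval `t`-coloring is unrolled along the integers, and the bound `t ≤ |V(G)|` is read
off from a density count. No bound on the degrees is needed.

The first ingredient concerns ordinary interval colorings: a triangle-free graph whose colors at
each vertex form an interval of integers has at least as many vertices as colors
(`SimpleGraph.card_colors_le_card_of_intervalColoring`). In a component with least color `a` and
greatest color `b`, take a geodesic from a vertex seeing `a` to a vertex `y` seeing `b` which at
each vertex leaves by the least color among the edges leading closer to `y`. A color `c` of `[a, b]`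
is either the color of a leaving edge, and is charged to the vertex left, or it is skipped at some
vertex `u` of the geodesic; the interval property then gives a neighbor `w` of `u` with
`uw` colored `c`, and `c` is charged to `w`. By the choice of leaving edges, `w` is not closer to `y`
than `u`. So `w` is off the geodesic, and two vertices of the geodesic sharing `w` would be
consecutive and form a triangle with it
(`SimpleGraph.exists_injOn_Icc_of_intervalColoring`).

The second ingredient is the infinite cyclic cover of `G`: modulo `t`, the colors at a vertex form
an arc, and the copies of the vertex correspond to the lifts of this arc to the integers. The cover
is triangle-free with an honest interval coloring. Over a window of `N * t + 1` consecutive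
integers it has at most `(N + 2) * |V(G)|` vertices, so `N * t + 1 ≤ (N + 2) * |V(G)|` for every
`N` (`CyclicInterval.IsCyclicIntervalColoring.window_le`), which forces `t ≤ |V(G)|`.
-/

/-! ### Interval colorings of triangle-free graphs -/

namespace SimpleGraph

variable {X : Type*} {H : SimpleGraph X}

/-- Among the neighbors of `v` that lie closer to `y`, one is reached by an edge of least color. -/
theorem exists_adj_closer_minimal (col : X → X → ℕ) {v y : X} (h : H.Reachable v y)
    (hne : v ≠ y) :
    ∃ w, H.Adj v w ∧ H.dist w y + 1 = H.dist v y ∧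
      ∀ z, H.Adj v z → H.dist z y + 1 = H.dist v y → col v w ≤ col v z := by
  classical
  have hex : ∃ c, ∃ w, H.Adj v w ∧ H.dist w y + 1 = H.dist v y ∧ col v w = c := by
    obtain ⟨p, hp⟩ := h.exists_walk_length_eq_dist
    cases p with
    | nil => exact absurd rfl hne
    | @cons _ w _ hvw q =>
      refine ⟨_, w, hvw, ?_, rfl⟩
      have h1 : H.dist w y ≤ q.length := dist_le q
      obtain ⟨r, hr⟩ := q.reachable.exists_walk_length_eq_dist
      have h2 : H.dist v y ≤ (Walk.cons hvw r).length := dist_le _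
      simp only [Walk.length_cons] at hp h2
      omega
  obtain ⟨w, hvw, hd, hc⟩ := Nat.find_spec hex
  refine ⟨w, hvw, hd, fun z hz hdz => ?_⟩
  rw [hc]
  exact Nat.find_min' hex ⟨z, hz, hdz, rfl⟩

/-- In a triangle-free graph with an interval coloring, a component in which the colors `a` and `b`
both occur has room for an injection from the integers of `[a, b]` to its vertices. The injection
comes from a geodesic towards a vertex `y` seeing `b` that always leaves by a closer edge of least
color. If `c` first fails to exceed the leaving color at `u`, then `c` is sent to `u` if it is the
leaving color, and otherwise to the neighbor of `u` along the edge colored `c`. In the second case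
that neighbor is not closer to `y` than `u`, so it is off the geodesic, and it serves no second
vertex of the geodesic, as that would close a triangle. -/
theorem exists_injOn_Icc_of_intervalColoring (col : X → X → ℕ)
    (symm : ∀ u v, H.Adj u v → col u v = col v u)
    (conv : ∀ v w w' c, H.Adj v w → H.Adj v w' → col v w ≤ c → c ≤ col v w' →
      ∃ z, H.Adj v z ∧ col v z = c)
    (tri : ∀ u v w, H.Adj u v → H.Adj v w → H.Adj u w → False)
    {x x' y y' : X} (hx : H.Adj x x') (hy : H.Adj y y') (hxy : H.Reachable x y) :
    ∃ f : ℕ → X, Set.InjOn f (Set.Icc (col x x') (col y y')) ∧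
      ∀ c ∈ Set.Icc (col x x') (col y y'), H.Reachable (f c) y := by
  classical
  have step : ∀ v, ∃ w, H.Reachable v y → v ≠ y → H.Adj v w ∧ H.dist w y + 1 = H.dist v y ∧
      ∀ z, H.Adj v z → H.dist z y + 1 = H.dist v y → col v w ≤ col v z := by
    intro v
    by_cases h : H.Reachable v y ∧ v ≠ y
    · obtain ⟨w, hw⟩ := exists_adj_closer_minimal col h.1 h.2
      exact ⟨w, fun _ _ => hw⟩
    · exact ⟨v, fun h1 h2 => absurd ⟨h1, h2⟩ h⟩
  choose nxt hnxt using step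
  set k := H.dist x y with hk
  set p : ℕ → X := fun i => nxt^[i] x with hp
  have p_succ : ∀ i, p (i + 1) = nxt (p i) := fun i => Function.iterate_succ_apply' nxt i x
  have hpd : ∀ i ≤ k, H.Reachable (p i) y ∧ H.dist (p i) y + i = k := by
    intro i
    induction i with
    | zero => exact fun _ => ⟨hxy, rfl⟩
    | succ i ih =>
      intro hi
      obtain ⟨hr, hd⟩ := ih (by omega)
      have hne : p i ≠ y := by
        intro h
        rw [h, dist_self] at hd
        omega
      obtain ⟨h1, h2, -⟩ := hnxt _ hr hne
      rw [p_succ]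
      exact ⟨h1.symm.reachable.trans hr, by omega⟩
  have hstep : ∀ i < k, H.Adj (p i) (p (i + 1)) ∧
      ∀ z, H.Adj (p i) z → H.dist z y + 1 = H.dist (p i) y →
        col (p i) (p (i + 1)) ≤ col (p i) z := by
    intro i hi
    obtain ⟨hr, hd⟩ := hpd i hi.le
    have hne : p i ≠ y := by
      intro h
      rw [h, dist_self] at hd
      omega
    obtain ⟨h1, -, h3⟩ := hnxt _ hr hne
    rw [p_succ]
    exact ⟨h1, h3⟩
  have hpk : p k = y := by
    obtain ⟨hr, hd⟩ := hpd k le_rfl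
    exact hr.dist_eq_zero_iff.1 (by omega)
  -- The color of the edge by which the geodesic leaves `p i`; the last vertex is `y`, which
  -- leaves by the edge to `y'`.
  set e : ℕ → ℕ := fun i => if i < k then col (p i) (p (i + 1)) else col y y' with he
  have e_lt : ∀ i < k, e i = col (p i) (p (i + 1)) := fun i hi => if_pos hi
  have e_k : e k = col y y' := if_neg (lt_irrefl k)
  have exit : ∀ i ≤ k, ∃ w, H.Adj (p i) w ∧ col (p i) w = e i := by
    intro i hi
    rcases hi.lt_or_eq with h | rfl
    · exact ⟨_, (hstep i h).1, (e_lt i h).symm⟩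
    · exact ⟨y', by rw [hpk]; exact hy, by rw [hpk, e_k]⟩
  have entry : ∀ i ≤ k, ∀ c, col x x' ≤ c → (∀ j < i, e j < c) →
      ∃ w, H.Adj (p i) w ∧ col (p i) w ≤ c := by
    intro i hi c hc hlt
    cases i with
    | zero => exact ⟨x', hx, hc⟩
    | succ i =>
      have h := (hstep i hi).1
      refine ⟨p i, h.symm, ?_⟩
      rw [← symm _ _ h, ← e_lt i hi]
      exact (hlt i (by omega)).le
  -- A vertex along a color below the leaving color of `p i` is not closer to `y` than `p i`.
  have far : ∀ i ≤ k, ∀ w, H.Adj (p i) w → col (p i) w < e i →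
      H.dist w y = k - i ∨ H.dist w y = k - i + 1 := by
    intro i hi w hw hlt
    obtain ⟨hr, hd⟩ := hpd i hi
    obtain ⟨q, hq⟩ := hr.exists_walk_length_eq_dist
    have h1 : H.dist w y ≤ (Walk.cons hw.symm q).length := dist_le _
    obtain ⟨q', hq'⟩ := (hw.symm.reachable.trans hr).exists_walk_length_eq_dist
    have h2 : H.dist (p i) y ≤ (Walk.cons hw q').length := dist_le _
    simp only [Walk.length_cons] at h1 h2
    have h3 : H.dist w y + 1 ≠ H.dist (p i) y := by
      intro h
      have hik : i < k := by omega
      have := (hstep i hik).2 w hw h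
      rw [e_lt i hik] at hlt
      omega
    omega
  let P : ℕ → X → ℕ → Prop := fun c w i => i ≤ k ∧ (∀ j < i, e j < c) ∧
    ((c = e i ∧ w = p i) ∨ (c < e i ∧ H.Adj (p i) w ∧ col (p i) w = c))
  have hex : ∀ c, ∃ w, c ∈ Set.Icc (col x x') (col y y') → ∃ i, P c w i := by
    intro c
    by_cases hc : c ∈ Set.Icc (col x x') (col y y')
    · have hi : ∃ i, c ≤ e i := ⟨k, by rw [e_k]; exact hc.2⟩
      have hik : Nat.find hi ≤ k := Nat.find_min' hi (by rw [e_k]; exact hc.2)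
      have hlt : ∀ j < Nat.find hi, e j < c := fun j hj => not_le.1 (Nat.find_min hi hj)
      rcases (Nat.find_spec hi).eq_or_lt with h | h
      · exact ⟨_, fun _ => ⟨_, hik, hlt, Or.inl ⟨h, rfl⟩⟩⟩
      · obtain ⟨w, hw, hwc⟩ := entry _ hik c hc.1 hlt
        obtain ⟨w', hw', hwe⟩ := exit _ hik
        obtain ⟨z, hz, hzc⟩ := conv _ _ _ c hw hw' hwc (hwe ▸ h.le)
        exact ⟨z, fun _ => ⟨_, hik, hlt, Or.inr ⟨h, hz, hzc⟩⟩⟩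
    · exact ⟨x, fun h => absurd h hc⟩
  choose f hf using hex
  have p_inj : ∀ i ≤ k, ∀ j ≤ k, p i = p j → i = j := by
    intro i hi j hj h
    have h1 := (hpd i hi).2
    have h2 := (hpd j hj).2
    rw [h] at h1
    omega
  have off : ∀ i ≤ k, ∀ j ≤ k, ∀ c, (∀ l < i, e l < c) → c < e i → H.Adj (p i) (p j) →
      col (p i) (p j) = c → False := by
    intro i hi j hj c hlt hce hadj hcol
    have h1 := far i hi _ hadj (hcol ▸ hce)
    have h2 := (hpd j hj).2
    have hij : j ≠ i := by
      rintro rfl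
      exact hadj.ne rfl
    obtain rfl : i = j + 1 := by omega
    have h3 := hlt j (by omega)
    rw [e_lt j (by omega), symm _ _ hadj.symm, hcol] at h3
    exact lt_irrefl _ h3
  have serve : ∀ i j, i < j → j ≤ k → ∀ w, H.Adj (p i) w → col (p i) w < e i →
      H.Adj (p j) w → col (p j) w < e j → False := by
    intro i j hij hj w hw hlt hw' hlt'
    have h1 := far i (by omega) w hw hlt
    have h2 := far j hj w hw' hlt'
    obtain rfl : j = i + 1 := by omega
    exact tri _ _ _ (hstep i (by omega)).1 hw' hw
  refine ⟨f, ?_, ?_⟩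
  · intro c hc c' hc' hff
    obtain ⟨i, hi, hlt, h⟩ := hf c hc
    obtain ⟨j, hj, hlt', h'⟩ := hf c' hc'
    rcases h with ⟨h1, h2⟩ | ⟨h1, h2, h3⟩ <;> rcases h' with ⟨h1', h2'⟩ | ⟨h1', h2', h3'⟩
    · rw [h1, h1', p_inj i hi j hj (by rw [← h2, ← h2', hff])]
    · rw [← hff, h2] at h2' h3'
      exact (off j hj i hi c' hlt' h1' h2' h3').elim
    · rw [hff, h2'] at h2 h3
      exact (off i hi j hj c hlt h1 h2 h3).elim
    · rw [← hff] at h2' h3'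
      rcases lt_trichotomy i j with hij | rfl | hij
      · exact (serve i j hij hj _ h2 (h3.trans_lt h1) h2' (h3'.trans_lt h1')).elim
      · rw [← h3, ← h3']
      · exact (serve j i hij hi _ h2' (h3'.trans_lt h1') h2 (h3.trans_lt h1)).elim
  · intro c hc
    obtain ⟨i, hi, -, ⟨-, h⟩ | ⟨-, h, -⟩⟩ := hf c hc
    · rw [h]
      exact (hpd i hi).1
    · exact h.symm.reachable.trans (hpd i hi).1

/-- A triangle-free graph with an interval coloring has at least as many vertices as colors. The
coloring need not be proper: `conv` alone says that the colors at each vertex form an interval. -/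
theorem card_colors_le_card_of_intervalColoring [Fintype X] (col : X → X → ℕ)
    (symm : ∀ u v, H.Adj u v → col u v = col v u)
    (conv : ∀ v w w' c, H.Adj v w → H.Adj v w' → col v w ≤ c → c ≤ col v w' →
      ∃ z, H.Adj v z ∧ col v z = c)
    (tri : ∀ u v w, H.Adj u v → H.Adj v w → H.Adj u w → False)
    (C : Finset ℕ) (hC : ∀ c ∈ C, ∃ u v, H.Adj u v ∧ col u v = c) :
    C.card ≤ Fintype.card X := by
  classical
  let colors : H.ConnectedComponent → Finset ℕ := fun K =>
    C.filter fun c => ∃ u v, H.Adj u v ∧ col u v = c ∧ H.connectedComponentMk u = K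
  have key : ∀ K, (colors K).card ≤
      (Finset.univ.filter fun v => H.connectedComponentMk v = K).card := by
    intro K
    rcases (colors K).eq_empty_or_nonempty with h | h
    · simp [h]
    obtain ⟨x, x', hx, hxa, hxK⟩ := (Finset.mem_filter.1 ((colors K).min'_mem h)).2
    obtain ⟨y, y', hy, hyb, hyK⟩ := (Finset.mem_filter.1 ((colors K).max'_mem h)).2
    obtain ⟨f, hinj, hreach⟩ := exists_injOn_Icc_of_intervalColoring col symm conv tri hx hy
      (ConnectedComponent.exact (hxK.trans hyK.symm))
    have hsub : ∀ c ∈ colors K, c ∈ Set.Icc (col x x') (col y y') := fun c hc =>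
      ⟨hxa ▸ Finset.min'_le _ _ hc, hyb ▸ Finset.le_max' _ _ hc⟩
    refine Finset.card_le_card_of_injOn f (fun c hc => ?_) (hinj.mono hsub)
    simp only [Finset.coe_filter, Finset.mem_univ, true_and, Set.mem_ofPred_eq]
    rw [← hyK]
    exact ConnectedComponent.sound (hreach c (hsub c hc))
  calc C.card ≤ (Finset.univ.biUnion colors).card := by
        refine Finset.card_le_card fun c hc => ?_
        obtain ⟨u, v, huv, h⟩ := hC c hc
        exact Finset.mem_biUnion.2 ⟨H.connectedComponentMk u, Finset.mem_univ _,
          Finset.mem_filter.2 ⟨hc, u, v, huv, h, rfl⟩⟩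
    _ ≤ ∑ K, (colors K).card := Finset.card_biUnion_le
    _ ≤ ∑ K, (Finset.univ.filter fun v => H.connectedComponentMk v = K).card :=
        Finset.sum_le_sum fun K _ => key K
    _ = Fintype.card X := by
        rw [← Finset.card_univ]
        exact (Finset.card_eq_sum_card_fiberwise fun v _ => Finset.mem_univ _).symm

end SimpleGraph

/-! ### Unrolling a cyclic interval coloring -/

namespace CyclicInterval

variable {V : Type*} {G : SimpleGraph V} {t : ℕ} {α : Sym2 V → ℕ}

/-- The integer representing the color of the edge `vw` modulo `t` when the colors at `v` are
unrolled to start at `s v`: colors below `s v` are moved one turn up. -/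
def unrolledColor (α : Sym2 V → ℕ) (t : ℕ) (s : V → ℕ) (v w : V) : ℕ :=
  α s(v, w) + if α s(v, w) < s v then t else 0

/-- With a suitable start at each vertex, the unrolled colors at the vertex form an interval. -/
theorem IsCyclicIntervalColoring.exists_start (hα : IsCyclicIntervalColoring G t α) :
    ∃ s : V → ℕ, ∀ v w w' c, G.Adj v w → G.Adj v w' → unrolledColor α t s v w ≤ c →
      c ≤ unrolledColor α t s v w' → ∃ z, G.Adj v z ∧ unrolledColor α t s v z = c := by
  have hmem : ∀ v w, G.Adj v w → α s(v, w) ∈ Set.Icc 1 t := fun v w h => hα.mem_Icc _ h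
  have main : ∀ v, ∃ a : ℕ, ∀ w w' c, G.Adj v w → G.Adj v w' →
      (α s(v, w) + if α s(v, w) < a then t else 0) ≤ c →
      (c ≤ α s(v, w') + if α s(v, w') < a then t else 0) →
      ∃ z, G.Adj v z ∧ (α s(v, z) + if α s(v, z) < a then t else 0) = c := by
    intro v
    rcases hα.interval v with ⟨a, b, h⟩ | ⟨a, b, h⟩
    · have hS : ∀ c, (∃ w, G.Adj v w ∧ α s(v, w) = c) ↔ a ≤ c ∧ c ≤ b := fun c =>
        Set.ext_iff.1 h c
      refine ⟨a, fun w w' c hw hw' h1 h2 => ?_⟩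
      have h3 := (hS _).1 ⟨w, hw, rfl⟩
      have h4 := (hS _).1 ⟨w', hw', rfl⟩
      rw [if_neg (by omega)] at h1 h2
      obtain ⟨z, hz, hzc⟩ := (hS c).2 (by omega)
      exact ⟨z, hz, by rw [if_neg (by omega)]; omega⟩
    · have hS : ∀ c, 1 ≤ c → c ≤ t →
          ((∃ w, G.Adj v w ∧ α s(v, w) = c) ↔ ¬(a ≤ c ∧ c ≤ b)) := by
        intro c hc hc'
        have h' := Set.ext_iff.1 h c
        simp only [Set.mem_sdiff, Set.mem_Icc, incidentColors, Set.mem_ofPred_eq] at h'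
        rw [← h', not_and, not_not]
        exact ⟨fun hw _ => hw, fun hw => hw ⟨hc, hc'⟩⟩
      refine ⟨a, fun w w' c hw hw' h1 h2 => ?_⟩
      have m1 := hmem v w hw
      have m2 := hmem v w' hw'
      have h3 := (hS _ m1.1 m1.2).1 ⟨w, hw, rfl⟩
      have h4 := (hS _ m2.1 m2.2).1 ⟨w', hw', rfl⟩
      have m3 := m1.1
      have m4 := m1.2
      have m5 := m2.1
      have m6 := m2.2
      by_cases hct : c ≤ t
      · have hca : a ≤ c ∧ b < c := by split_ifs at h1 h2 <;> omega
        obtain ⟨z, hz, hzc⟩ := (hS c (by omega) hct).2 (by omega)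
        exact ⟨z, hz, by rw [if_neg (by omega)]; omega⟩
      · have hca : c - t < a ∧ c - t ≤ t := by split_ifs at h1 h2 <;> omega
        obtain ⟨z, hz, hzc⟩ := (hS (c - t) (by omega) hca.2).2 (by omega)
        exact ⟨z, hz, by rw [if_pos (by omega)]; omega⟩
  choose s hs using main
  exact ⟨s, hs⟩

theorem IsCyclicIntervalColoring.exists_unrolledColor_eq (hα : IsCyclicIntervalColoring G t α)
    (s : V → ℕ) {v w : V} (h : G.Adj v w) :
    1 ≤ unrolledColor α t s v w ∧ unrolledColor α t s v w ≤ 2 * t ∧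
      ∃ i, i ≤ 1 ∧ unrolledColor α t s v w = α s(v, w) + i * t := by
  have h1 := (hα.mem_Icc s(v, w) h).1
  have h2 := (hα.mem_Icc s(v, w) h).2
  unfold unrolledColor
  split_ifs
  · exact ⟨by omega, by omega, 1, by omega, by omega⟩
  · exact ⟨by omega, by omega, 0, by omega, by omega⟩

/-- The part of the infinite cyclic cover of `G` that carries the colors `2 * t, …, (N + 2) * t`.
The vertex `(v, k)` is the copy of `v` on which the edge `vw` has the color
`unrolledColor α t s v w + k * t`, and two copies are adjacent if they agree on this color. All
copies that meet a color of the window have `k < N + 2`, so truncation cuts no interval in two. -/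
def unrolledGraph (G : SimpleGraph V) (α : Sym2 V → ℕ) (t : ℕ) (s : V → ℕ) (N : ℕ) :
    SimpleGraph (V × Fin (N + 2)) where
  Adj x y := G.Adj x.1 y.1 ∧
    unrolledColor α t s x.1 y.1 + x.2 * t = unrolledColor α t s y.1 x.1 + y.2 * t ∧
    2 * t ≤ unrolledColor α t s x.1 y.1 + x.2 * t ∧
    unrolledColor α t s x.1 y.1 + x.2 * t ≤ (N + 2) * t
  symm := ⟨fun _ _ h => ⟨h.1.symm, h.2.1.symm, h.2.1 ▸ h.2.2.1, h.2.1 ▸ h.2.2.2⟩⟩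
  loopless := ⟨fun _ h => h.1.ne rfl⟩

/-- An integer of the window congruent to the color of the edge `vw` is a color at some copy
of `v`. -/
theorem IsCyclicIntervalColoring.exists_copy (hα : IsCyclicIntervalColoring G t α) (s : V → ℕ)
    {N : ℕ} {v w : V} (h : G.Adj v w) {c m : ℕ} (hc : c = α s(v, w) + m * t)
    (h1 : 2 * t ≤ c) (h2 : c ≤ (N + 2) * t) :
    ∃ k : Fin (N + 2), unrolledColor α t s v w + k * t = c := by
  obtain ⟨hp1, hp2, i, hi, hpi⟩ := hα.exists_unrolledColor_eq s h
  have h3 := (hα.mem_Icc s(v, w) h).2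
  have h4 := (hα.mem_Icc s(v, w) h).1
  have him : i ≤ m := by
    by_contra hlt
    obtain rfl : m = 0 := by omega
    omega
  obtain ⟨k, rfl⟩ := Nat.exists_eq_add_of_le him
  have hk : unrolledColor α t s v w + k * t = c := by rw [hpi, hc]; ring
  refine ⟨⟨k, ?_⟩, hk⟩
  by_contra hge
  have := Nat.mul_le_mul_right t (not_lt.1 hge)
  omega

/-- The number of colors in the window is at most the number of vertices that carry it. -/
theorem IsCyclicIntervalColoring.window_le [Fintype V] (htri : G.CliqueFree 3)
    (hα : IsCyclicIntervalColoring G t α) (ht : 0 < t) (N : ℕ) :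
    N * t + 1 ≤ Fintype.card V * (N + 2) := by
  classical
  obtain ⟨s, hs⟩ := hα.exists_start
  have lift : ∀ v w : V, G.Adj v w → ∀ c m, c = α s(v, w) + m * t → 2 * t ≤ c →
      c ≤ (N + 2) * t → ∀ k : Fin (N + 2), unrolledColor α t s v w + k * t = c →
      ∃ l, (unrolledGraph G α t s N).Adj (v, k) (w, l) := by
    intro v w h c m hc h1 h2 k hk
    obtain ⟨l, hl⟩ := hα.exists_copy s h.symm (by rw [Sym2.eq_swap]; exact hc) h1 h2
    exact ⟨l, h, by simp only [hk, hl], by simp only [hk, h1], by simp only [hk, h2]⟩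
  have hcard := SimpleGraph.card_colors_le_card_of_intervalColoring
    (H := unrolledGraph G α t s N)
    (fun x y => unrolledColor α t s x.1 y.1 + x.2 * t) (fun x y h => h.2.1) ?_ ?_
    (Finset.Icc (2 * t) ((N + 2) * t)) ?_
  · rw [Nat.card_Icc, Fintype.card_prod, Fintype.card_fin] at hcard
    have : (N + 2) * t = N * t + 2 * t := by ring
    omega
  · rintro ⟨v, k⟩ ⟨w, l⟩ ⟨w', l'⟩ c ⟨h1, -, h2, -⟩ ⟨h1', -, -, h2'⟩ hc hc'
    dsimp only at *
    obtain ⟨z, hz, hzc⟩ := hs v w w' (c - k * t) h1 h1' (by omega) (by omega)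
    have hk : unrolledColor α t s v z + k * t = c := by omega
    obtain ⟨-, -, i, -, hi⟩ := hα.exists_unrolledColor_eq s hz
    obtain ⟨l'', hl⟩ := lift v z hz c (i + k) (by rw [← hk, hi]; ring) (by omega) (by omega) k hk
    exact ⟨(z, l''), hl, hk⟩
  · rintro ⟨u, i⟩ ⟨v, j⟩ ⟨w, k⟩ h1 h2 h3
    exact htri {u, v, w} (SimpleGraph.is3Clique_iff.2 ⟨u, v, w, h1.1, h3.1, h2.1, rfl⟩)
  · intro c hc
    obtain ⟨hc1, hc2⟩ := Finset.mem_Icc.1 hc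
    -- The residue of `c` is taken in `1, …, t`.
    have hmod := Nat.mod_lt (c - 1) ht
    obtain ⟨⟨v, w⟩, he, hcol⟩ := hα.nonempty ((c - 1) % t + 1) ⟨by omega, by omega⟩
    have hvw : G.Adj v w := he
    have hcm : c = α s(v, w) + (c - 1) / t * t := by
      have := Nat.mod_add_div (c - 1) t
      have hcol' : α s(v, w) = (c - 1) % t + 1 := hcol
      rw [hcol', mul_comm]
      omega
    obtain ⟨k, hk⟩ := hα.exists_copy s hvw hcm hc1 hc2
    obtain ⟨l, hl⟩ := lift v w hvw c _ hcm hc1 hc2 k hk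
    exact ⟨(v, k), (w, l), hl, hk⟩

theorem IsCyclicIntervalColoring.le_card [Fintype V] (htri : G.CliqueFree 3)
    (hα : IsCyclicIntervalColoring G t α) : t ≤ Fintype.card V := by
  rcases Nat.eq_zero_or_pos t with rfl | ht
  · exact Nat.zero_le _
  by_contra hlt
  -- `2 * n` turns are enough for the excess of `t` over `n` to outweigh the two extra turns.
  have h := hα.window_le htri ht (2 * Fintype.card V)
  nlinarith [Nat.mul_le_mul_left (2 * Fintype.card V) (not_le.1 hlt)]

end CyclicInterval

theorem mainTheorem2 {V : Type*} [Fintype V] (G : SimpleGraph V) [DecidableRel G.Adj]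
    (htri : G.CliqueFree 3) (hG : CyclicInterval.CyclicallyIntervalColorable G)
    (hdeg : G.maxDegree ≤ 4) :
    CyclicInterval.Wc G ≤ Fintype.card V := by
  obtain ⟨α, hα⟩ := (CyclicInterval.isGreatest_Wc G hG).1
  exact hα.le_card htri
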